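/- Let $(\mathcal G,\underline a)$ be a finite metric graph with finite set $\mathcal E$ of external edges $e$, identified with $I_e=[0,\infty)$, and finite set $\mathcal I$ of internal edges $i$, identified with $I_i=[0,a_i]$, $0<a_i<\infty$. Put $d:=|\mathcal E|+2|\mathcal I|$, $\mathcal H:=\bigoplus_{j\in\mathcal E\cup\mathcal I}L^2(I_j;\mathbb C)$, $\mathcal K:=\mathbb C^{|\mathcal E|}\oplus\mathbb C^{|\mathcal I|}\oplus\mathbb C^{|\mathcal I|}$, and let $\mathcal D$ be the set of all $\psi\in\mathcal H$ such that on each edge $\psi_j$ and $\psi_j'$ are absolutely continuous (on compact subintervals) and $\psi_j''\in L^2(I_j)$. For $\psi\in\mathcal D$ let $$[\psi]:=\underline\psi\oplus\underline\psi'\in\mathcal K\oplus\mathcal K,\qquad \underline\psi=\begin{bmatrix}\{\psi_e(0)\}_{e}\\ \{\psi_i(0)\}_{i}\\ \{\psi_i(a_i)\}_{i}\end{bmatrix},\quad \underline\psi'=\begin{bmatrix}\{\psi_e'(0)\}_{e}\\ \{\psi_i'(0)\}_{i}\\ \{-\psi_i'(a_i)\}_{i}\end{bmatrix}.$$ For a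 linear subspace $\mathcal M\subset\mathcal K\oplus\mathcal K$ let $\Delta(\mathcal M)$ be the operator in $\mathcal H$ with domain $\{\psi\in\mathcal D: [\psi]\in\mathcal M\}$ acting as $(\Delta(\mathcal M)\psi)_j=\psi_j''$. A number $z\in\mathbb C$ lies in the spectrum $\sigma(\Delta(\mathcal M))$ unless $\Delta(\mathcal M)-z$ is a bijection from its domain onto $\mathcal H$ with bounded inverse, and $\sigma_{\mathrm p}(\Delta(\mathcal M))$ denotes the set of eigenvalues. For linear maps $A,B$ in $\mathcal K$ put $\mathcal M(A,B):=\{\chi_1\oplus\chi_2: A\chi_1+B\chi_2=0\}$ and, for $k\in\mathbb C$, $$Z(k;A,B,\underline a):=A\,X(k;\underline a)+ik\,B\,Y(k;\underline a),$$ $$X(k;\underline a)=\begin{bmatrix}1&0&0\\0&1&1\\0&e^{ik\underline a}&e^{-ik\underline a}\end{bmatrix},\qquad Y(k;\underline a)=\begin{bmatrix}1&0&0\\0&1&-1\\0&-e^{ik\underline a}&e^{-ik\underline a}\end{bmatrix},$$ where $e^{\pm ik\underline a}$ is the diagonal matrix with entries $e^{\pm ika_i}$, $i\in\mathcal I$.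 Then the following holds for every linear subspace $\mathcal M\subset\mathcal K\oplus\mathcal K$. 1. If $\dim\mathcal M\neq d$, then $\sigma(\Delta(\mathcal M))=\mathbb C$. 2. If $\dim\mathcal M>d$, then the closure of $\sigma_{\mathrm p}(\Delta(\mathcal M))$ in $\mathbb C$ is $\mathbb C$. Moreover, in this case there are linear maps $A,B$ in $\mathcal K$ with $\mathcal M=\mathcal M(A,B)$, and for all such $A,B$ one has $\det Z(k;A,B,\underline a)=0$ for every $k\in\mathbb C$. -/

import Mathlib

open MeasureTheory Set

noncomputable section

namespace QuantumGraph

/-! ### Spectra of unbounded operators -/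

section Spectra

variable {F : Type*} [NormedAddCommGroup F] [NormedSpace ℂ F]

/-- `z` is in the resolvent set of the operator `T` if `T - z : Dom T → F` is bijective with a
bounded everywhere defined inverse `R`. -/
def resolventSet (T : F →ₗ.[ℂ] F) : Set ℂ :=
  {z | ∃ R : F →L[ℂ] F,
    (∀ y : F, ∃ x : T.domain, (x : F) = R y ∧ T x - z • (x : F) = y) ∧
    ∀ x : T.domain, R (T x - z • (x : F)) = x}

/-- The spectrum, the complement of the resolvent set in `ℂ`. -/
def spectrum (T : F →ₗ.[ℂ] F) : Set ℂ := (resolventSet T)ᶜ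

/-- The point spectrum, the set of eigenvalues. -/
def pointSpectrum (T : F →ₗ.[ℂ] F) : Set ℂ :=
  {z | ∃ x : T.domain, (x : F) ≠ 0 ∧ T x = z • (x : F)}

end Spectra

/-! ### Finite metric graphs -/

/-- A metric graph with vertex set `V`, external edges `E` and internal edges `I`. -/
structure MetricGraph (V E I : Type*) where
  /-- the initial vertex of an external edge -/
  extVertex : E → V
  /-- the initial vertex of an internal edge -/
  initVertex : I → V
  /-- the terminal vertex of an internal edge -/
  termVertex : I → V
  /-- the length of an internal edge -/
  len : I → ℝ
  len_pos : ∀ i, 0 < len i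

variable {V E I : Type*}

/-- The auxiliary space `𝒦 = ℂ^E ⊕ ℂ^I ⊕ ℂ^I`; the coordinates are indexed by the ends of edges. -/
abbrev BdrySpace (E I : Type*) [Fintype E] [Fintype I] : Type _ :=
  EuclideanSpace ℂ (E ⊕ (I ⊕ I))

namespace MetricGraph

variable (G : MetricGraph V E I)

/-- The interval of an edge: `[0, ∞)` for external edges, `[0, a i]` for internal ones. -/
def edgeSet : E ⊕ I → Set ℝ
  | .inl _ => Ici 0
  | .inr i => Icc 0 (G.len i)

/-- On the interval `S`, the function `f` belongs to `L²`, `f` and its derivative `f'` are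
absolutely continuous (on compact subintervals), and the almost everywhere derivative `f''` of `f'`
belongs to `L²`. -/
structure IsH2 (S : Set ℝ) (f f' f'' : ℝ → ℂ) : Prop where
  memLp : MemLp f 2 (volume.restrict S)
  absCont : ∀ x ∈ S, ∀ y ∈ S, AbsolutelyContinuousOnInterval f x y
  hasDeriv : ∀ x ∈ S, HasDerivWithinAt f (f' x) S x
  absCont_deriv : ∀ x ∈ S, ∀ y ∈ S, AbsolutelyContinuousOnInterval f' x y
  hasDeriv_deriv : ∀ᵐ x ∂(volume.restrict S), HasDerivWithinAt f' (f'' x) S x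
  memLp_deriv2 : MemLp f'' 2 (volume.restrict S)

lemma subset_closure_interior (j : E ⊕ I) : G.edgeSet j ⊆ closure (interior (G.edgeSet j)) := by
  rcases j with e | i
  · simp [edgeSet]
  · simp [edgeSet, closure_Ioo (G.len_pos i).ne]

lemma uniqueDiffOn (j : E ⊕ I) : UniqueDiffOn ℝ (G.edgeSet j) := by
  rcases j with e | i
  · exact uniqueDiffOn_Ici 0
  · exact uniqueDiffOn_Icc (G.len_pos i)

lemma measurableSet_edgeSet (j : E ⊕ I) : MeasurableSet (G.edgeSet j) := by
  rcases j with e | i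
  · exact measurableSet_Ici
  · exact measurableSet_Icc

lemma IsH2.add {S : Set ℝ} {f f' f'' g g' g'' : ℝ → ℂ} (hf : IsH2 S f f' f'')
    (hg : IsH2 S g g' g'') : IsH2 S (f + g) (f' + g') (f'' + g'') where
  memLp := hf.memLp.add hg.memLp
  absCont x hx y hy := (hf.absCont x hx y hy).add (hg.absCont x hx y hy)
  hasDeriv x hx := (hf.hasDeriv x hx).add (hg.hasDeriv x hx)
  absCont_deriv x hx y hy := (hf.absCont_deriv x hx y hy).add (hg.absCont_deriv x hx y hy)
  hasDeriv_deriv := by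
    filter_upwards [hf.hasDeriv_deriv, hg.hasDeriv_deriv] with x h1 h2 using h1.add h2
  memLp_deriv2 := hf.memLp_deriv2.add hg.memLp_deriv2

lemma IsH2.smul {S : Set ℝ} {f f' f'' : ℝ → ℂ} (c : ℂ) (hf : IsH2 S f f' f'') :
    IsH2 S (c • f) (c • f') (c • f'') where
  memLp := hf.memLp.const_smul c
  absCont x hx y hy := (hf.absCont x hx y hy).const_smul c
  hasDeriv x hx := (hf.hasDeriv x hx).const_smul c
  absCont_deriv x hx y hy := (hf.absCont_deriv x hx y hy).const_smul c
  hasDeriv_deriv := by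
    filter_upwards [hf.hasDeriv_deriv] with x h1 using h1.const_smul c
  memLp_deriv2 := hf.memLp_deriv2.const_smul c

lemma isH2_zero (S : Set ℝ) : IsH2 S 0 0 0 where
  memLp := MemLp.zero
  absCont x _ y _ := (LipschitzWith.const (0 : ℂ)).lipschitzOnWith.absolutelyContinuousOnInterval
  hasDeriv x _ := hasDerivWithinAt_const x S (0 : ℂ)
  absCont_deriv x _ y _ :=
    (LipschitzWith.const (0 : ℂ)).lipschitzOnWith.absolutelyContinuousOnInterval
  hasDeriv_deriv := Filter.Eventually.of_forall fun x => hasDerivWithinAt_const x S (0 : ℂ)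
  memLp_deriv2 := MemLp.zero

variable [Fintype E] [Fintype I]

/-- The Hilbert space `ℋ`, the Hilbert direct sum of the `L²` spaces of the edges. -/
abbrev Hilb : Type _ :=
  PiLp 2 (fun j : E ⊕ I => Lp ℂ 2 (volume.restrict (G.edgeSet j)))

/-- The family of functions `f j` on the edges represents `ψ ∈ ℋ` and is edgewise in `𝒟 j`, with
first and second derivatives `f' j` and `f'' j`. -/
def IsRep (ψ : G.Hilb) (f f' f'' : E ⊕ I → ℝ → ℂ) : Prop :=
  ∀ j, IsH2 (G.edgeSet j) (f j) (f' j) (f'' j) ∧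
    (ψ j : ℝ → ℂ) =ᵐ[volume.restrict (G.edgeSet j)] f j

variable {G}

lemma IsRep.add {ψ φ : G.Hilb} {f f' f'' g g' g'' : E ⊕ I → ℝ → ℂ} (hf : G.IsRep ψ f f' f'')
    (hg : G.IsRep φ g g' g'') : G.IsRep (ψ + φ) (f + g) (f' + g') (f'' + g'') := fun j => by
  refine ⟨(hf j).1.add (hg j).1, ?_⟩
  filter_upwards [Lp.coeFn_add (ψ j) (φ j), (hf j).2, (hg j).2] with x h1 h2 h3
  simp only [PiLp.add_apply, h1, Pi.add_apply, h2, h3]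

lemma IsRep.smul {ψ : G.Hilb} {f f' f'' : E ⊕ I → ℝ → ℂ} (c : ℂ) (hf : G.IsRep ψ f f' f'') :
    G.IsRep (c • ψ) (c • f) (c • f') (c • f'') := fun j => by
  refine ⟨(hf j).1.smul c, ?_⟩
  filter_upwards [Lp.coeFn_smul c (ψ j), (hf j).2] with x h1 h2
  simp only [PiLp.smul_apply, h1, Pi.smul_apply, h2]

/-- Representatives are unique on the edges. -/
lemma IsRep.unique {ψ : G.Hilb} {f f' f'' g g' g'' : E ⊕ I → ℝ → ℂ} (hf : G.IsRep ψ f f' f'')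
    (hg : G.IsRep ψ g g' g'') (j : E ⊕ I) :
    EqOn (f j) (g j) (G.edgeSet j) ∧ EqOn (f' j) (g' j) (G.edgeSet j) ∧
      f'' j =ᵐ[volume.restrict (G.edgeSet j)] g'' j := by
  have h0 : EqOn (f j) (g j) (G.edgeSet j) :=
    Measure.eqOn_of_ae_eq ((hf j).2.symm.trans (hg j).2)
      (fun x hx => ((hf j).1.hasDeriv x hx).continuousWithinAt)
      (fun x hx => ((hg j).1.hasDeriv x hx).continuousWithinAt) (G.subset_closure_interior j)
  have h1 : EqOn (f' j) (g' j) (G.edgeSet j) := fun x hx =>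
    (G.uniqueDiffOn j x hx).eq_deriv _ ((hf j).1.hasDeriv x hx)
      (((hg j).1.hasDeriv x hx).congr h0 (h0 hx))
  refine ⟨h0, h1, ?_⟩
  filter_upwards [(hf j).1.hasDeriv_deriv, (hg j).1.hasDeriv_deriv,
    ae_restrict_mem (G.measurableSet_edgeSet j)] with x h2 h3 hx
  exact (G.uniqueDiffOn j x hx).eq_deriv _ h2 (h3.congr h1 (h1 hx))

variable (G)

/-- The space `𝒟 = ⨁ 𝒟 j`. -/
def maxDomain : Submodule ℂ G.Hilb where
  carrier := {ψ | ∃ f f' f'', G.IsRep ψ f f' f''}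
  add_mem' := by
    rintro ψ φ ⟨f, f', f'', hf⟩ ⟨g, g', g'', hg⟩
    exact ⟨_, _, _, hf.add hg⟩
  zero_mem' := ⟨0, 0, 0, fun j => ⟨isH2_zero _, Lp.coeFn_zero ..⟩⟩
  smul_mem' := by
    rintro c ψ ⟨f, f', f'', hf⟩
    exact ⟨_, _, _, hf.smul c⟩

variable {G}

/-- The (absolutely continuous) representative of `ψ ∈ 𝒟`; it is unique on the edges. -/
def rep (ψ : G.maxDomain) : E ⊕ I → ℝ → ℂ := ψ.2.choose

/-- The first derivative of `ψ ∈ 𝒟`. -/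
def rep' (ψ : G.maxDomain) : E ⊕ I → ℝ → ℂ := ψ.2.choose_spec.choose

/-- The second derivative of `ψ ∈ 𝒟`. -/
def rep'' (ψ : G.maxDomain) : E ⊕ I → ℝ → ℂ := ψ.2.choose_spec.choose_spec.choose

lemma isRep_rep (ψ : G.maxDomain) : G.IsRep ψ (rep ψ) (rep' ψ) (rep'' ψ) :=
  ψ.2.choose_spec.choose_spec.choose_spec

variable (G)

/-- The differential operator `Δ` in `ℋ`, acting as `ψ ↦ ψ''` edgewise, with domain `𝒟`. -/
def maxLaplacian : G.Hilb →ₗ.[ℂ] G.Hilb where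
  domain := G.maxDomain
  toFun :=
    { toFun := fun ψ => WithLp.toLp 2 fun j => (isRep_rep ψ j).1.memLp_deriv2.toLp (rep'' ψ j)
      map_add' := fun ψ φ => by
        ext1 j
        simp only [PiLp.add_apply]
        rw [← MemLp.toLp_add, MemLp.toLp_eq_toLp_iff]
        exact ((isRep_rep (ψ + φ)).unique ((isRep_rep ψ).add (isRep_rep φ)) j).2.2
      map_smul' := fun c ψ => by
        ext1 j
        simp only [PiLp.smul_apply, RingHom.id_apply]
        rw [← MemLp.toLp_const_smul, MemLp.toLp_eq_toLp_iff]
        exact ((isRep_rep (c • ψ)).unique ((isRep_rep ψ).smul c) j).2.2 }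

/-- The vector of boundary values of a family of functions on the edges. -/
def bdryVal (f : E ⊕ I → ℝ → ℂ) : BdrySpace E I :=
  WithLp.toLp 2 fun
    | .inl e => f (.inl e) 0
    | .inr (.inl i) => f (.inr i) 0
    | .inr (.inr i) => f (.inr i) (G.len i)

/-- The vector of boundary values of the inward derivatives, from the family of derivatives. -/
def bdryDeriv (f' : E ⊕ I → ℝ → ℂ) : BdrySpace E I :=
  WithLp.toLp 2 fun
    | .inl e => f' (.inl e) 0
    | .inr (.inl i) => f' (.inr i) 0
    | .inr (.inr i) => -f' (.inr i) (G.len i)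

variable {G}

lemma IsRep.bdry_unique {ψ : G.Hilb} {f f' f'' g g' g'' : E ⊕ I → ℝ → ℂ}
    (hf : G.IsRep ψ f f' f'') (hg : G.IsRep ψ g g' g'') :
    G.bdryVal f = G.bdryVal g ∧ G.bdryDeriv f' = G.bdryDeriv g' := by
  have he : ∀ e, (0 : ℝ) ∈ G.edgeSet (.inl e) := fun e => by simp [edgeSet]
  have hi : ∀ i, (0 : ℝ) ∈ G.edgeSet (.inr i) := fun i => by simp [edgeSet, (G.len_pos i).le]
  have hl : ∀ i, G.len i ∈ G.edgeSet (.inr i) := fun i => by simp [edgeSet, (G.len_pos i).le]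
  constructor
  · ext j
    rcases j with e | i | i
    · exact (hf.unique hg (.inl e)).1 (he e)
    · exact (hf.unique hg (.inr i)).1 (hi i)
    · exact (hf.unique hg (.inr i)).1 (hl i)
  · ext j
    rcases j with e | i | i
    · exact (hf.unique hg (.inl e)).2.1 (he e)
    · exact (hf.unique hg (.inr i)).2.1 (hi i)
    · exact congrArg Neg.neg ((hf.unique hg (.inr i)).2.1 (hl i))

variable (G)

/-- The boundary trace `[ψ] = (boundary values) ⊕ (boundary values of inward derivatives)`. -/
def trace : G.maxDomain →ₗ[ℂ] BdrySpace E I × BdrySpace E I where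
  toFun ψ := (G.bdryVal (rep ψ), G.bdryDeriv (rep' ψ))
  map_add' ψ φ := by
    have h := (isRep_rep (ψ + φ)).bdry_unique ((isRep_rep ψ).add (isRep_rep φ))
    rw [h.1, h.2]
    refine Prod.ext ?_ ?_ <;> ext j <;> rcases j with e | i | i <;>
      simp [bdryVal, bdryDeriv, add_comm]
  map_smul' c ψ := by
    have h := (isRep_rep (c • ψ)).bdry_unique ((isRep_rep ψ).smul c)
    rw [h.1, h.2]
    refine Prod.ext ?_ ?_ <;> ext j <;> rcases j with e | i | i <;>
      simp [bdryVal, bdryDeriv]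

/-- The Laplacian `Δ(ℳ)`: the restriction of `Δ` to `{ψ ∈ 𝒟 | [ψ] ∈ ℳ}`. -/
def laplacian (M : Submodule ℂ (BdrySpace E I × BdrySpace E I)) : G.Hilb →ₗ.[ℂ] G.Hilb :=
  G.maxLaplacian.domRestrict ((M.comap G.trace).map G.maxDomain.subtype)

end MetricGraph

/-! ### The secular determinant -/

/-- `ℳ(A, B) = Ker (A, B)`, where `(A, B) (χ₁ ⊕ χ₂) = A χ₁ + B χ₂`. -/
def bdrySubspace [Fintype E] [Fintype I] (A B : BdrySpace E I →ₗ[ℂ] BdrySpace E I) :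
    Submodule ℂ (BdrySpace E I × BdrySpace E I) :=
  LinearMap.ker (A.coprod B)

namespace MetricGraph

variable [DecidableEq E] [DecidableEq I] (G : MetricGraph V E I)

/-- The diagonal matrix `e^{ika}`. -/
def expMatrix (k : ℂ) : Matrix I I ℂ :=
  Matrix.diagonal fun i => Complex.exp (Complex.I * k * (G.len i : ℂ))

/-- The matrix `X(k; a)`. -/
def matX (k : ℂ) : Matrix (E ⊕ (I ⊕ I)) (E ⊕ (I ⊕ I)) ℂ :=
  Matrix.fromBlocks 1 0 0 (Matrix.fromBlocks 1 1 (G.expMatrix k) (G.expMatrix (-k)))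

/-- The matrix `Y(k; a)`. -/
def matY (k : ℂ) : Matrix (E ⊕ (I ⊕ I)) (E ⊕ (I ⊕ I)) ℂ :=
  Matrix.fromBlocks 1 0 0 (Matrix.fromBlocks 1 (-1) (-G.expMatrix k) (G.expMatrix (-k)))

/-- `Z(k; A, B, a) = A X(k; a) + i k B Y(k; a)`. -/
def secularMap [Fintype E] [Fintype I] (A B : BdrySpace E I →ₗ[ℂ] BdrySpace E I) (k : ℂ) :
    BdrySpace E I →ₗ[ℂ] BdrySpace E I :=
  A ∘ₗ Matrix.toEuclideanLin (G.matX k) +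
    (Complex.I * k) • (B ∘ₗ Matrix.toEuclideanLin (G.matY k))

end MetricGraph

end QuantumGraph

end

noncomputable section

namespace QuantumGraph

/-! ### Solutions of the eigenvalue equation on an interval -/

/-! Both halves compare `M` with the boundary values of solutions of `ψ'' = z ψ` inside `𝒦 ⊕ 𝒦`,
which has dimension `2d`.

If `dim M > d`, then for each `k` the vectors `(X(k) c, ik Y(k) c)` depend linearly on `c ∈ 𝒦`, and
since `M` has codimension below `d`, some `c ≠ 0` lands in `M` (`exists_ne_zero_map_mem`). This `c`
lies in the kernel of `Z(k)`, so the determinant vanishes. When `Im k > 0` the exponential solution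
with coefficients `c` is square integrable, hence an eigenfunction for `-k²`. These values include
every nonreal number, so the point spectrum is dense, and its closure lies in the spectrum.

If `dim M < d`, suppose that `z` is in the resolvent set. Every boundary vector is a trace `[ψ]`;
solving `(Δ(M) - z) φ = (Δ - z) ψ` gives `[ψ] = [φ] + [ψ - φ]`, with `[φ] ∈ M` and `ψ - φ` a square
integrable solution of the homogeneous equation. The traces of such solutions have dimension at most
`d`, for every complex `z`: one parameter per external edge, two per internal edge. Thus `2d ≤ dim M
+ d`, a contradiction. -/

lemma eq_of_ae_hasDerivWithinAt_zero {S : Set ℝ} (hS : S.OrdConnected) (hSm : MeasurableSet S)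
    {g : ℝ → ℂ} {a : ℝ} (ha : a ∈ S) (hg : ∀ x ∈ S, AbsolutelyContinuousOnInterval g a x)
    (hd : ∀ᵐ x ∂(volume.restrict S), HasDerivWithinAt g 0 S x) {x : ℝ} (hx : x ∈ S) :
    g x = g a := by
  obtain ⟨C, hC⟩ := (hg x hx).const_of_ae_hasDerivAt_zero (by
    rw [ae_restrict_iff' hSm] at hd
    filter_upwards [hd, Measure.ae_ne volume a, Measure.ae_ne volume x] with y hy hya hyx hmem
    have hsub : uIcc a x ⊆ S := hS.uIcc_subset ha hx
    -- Off the two endpoints, a null set, `S` is a neighbourhood of `y`, so the one-sided notion of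
    -- derivative becomes the full one.
    refine (hy (hsub hmem)).hasDerivAt (Filter.mem_of_superset ?_ hsub)
    refine Icc_mem_nhds (lt_of_le_of_ne hmem.1 ?_) (lt_of_le_of_ne hmem.2 ?_)
    · rcases min_choice a x with h | h <;> rw [h]
      exacts [hya.symm, hyx.symm]
    · rcases max_choice a x with h | h <;> rw [h]
      exacts [hya, hyx])
  rw [hC x right_mem_uIcc, hC a left_mem_uIcc]

lemma hasDerivAt_cexp_mul (w : ℂ) (x : ℝ) :
    HasDerivAt (fun x : ℝ => Complex.exp (w * x)) (w * Complex.exp (w * x)) x := by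
  have h : HasDerivAt (fun x : ℝ => w * (x : ℂ)) w x := by
    simpa using (Complex.ofRealCLM.hasDerivAt (x := x)).const_mul w
  simpa [mul_comm] using h.cexp

lemma contDiff_cexp_mul (w : ℂ) {n : WithTop ℕ∞} :
    ContDiff ℝ n fun x : ℝ => Complex.exp (w * x) :=
  (contDiff_const.mul Complex.ofRealCLM.contDiff).cexp

namespace MetricGraph

/-- Factoring `D² - κ² = (D - κ)(D + κ)`: the function `f' + κ f` solves a first-order equation, and
`e^{-κx}` is its integrating factor. -/
lemma IsH2.exp_mul_eq {S : Set ℝ} (hS : S.OrdConnected) (hSm : MeasurableSet S)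
    {f f' f'' : ℝ → ℂ} (h : IsH2 S f f' f'') {z κ : ℂ} (hκ : κ ^ 2 = z)
    (hz : f'' =ᵐ[volume.restrict S] fun x => z * f x) {a x : ℝ} (ha : a ∈ S) (hx : x ∈ S) :
    Complex.exp (-κ * x) * (f' x + κ * f x) = Complex.exp (-κ * a) * (f' a + κ * f a) := by
  refine eq_of_ae_hasDerivWithinAt_zero (g := fun x => Complex.exp (-κ * x) * (f' x + κ * f x))
    hS hSm ha (fun y hy => ?_) ?_ hx
  · exact (contDiff_cexp_mul (-κ)).contDiffOn.absolutelyContinuousOnInterval.fun_smul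
      ((h.absCont_deriv a ha y hy).fun_add ((h.absCont a ha y hy).const_smul κ))
  · filter_upwards [h.hasDeriv_deriv, hz, ae_restrict_mem hSm] with y h1 h2 hy
    refine ((hasDerivAt_cexp_mul (-κ) y).hasDerivWithinAt.mul
      (h1.add ((h.hasDeriv y hy).const_mul κ))).congr_deriv ?_
    rw [h2, ← hκ]
    simp only [Pi.add_apply]
    ring

/-- With zero initial data the first integral of `IsH2.exp_mul_eq` vanishes, so `f' = -κ f`; the
integrating factor `e^{κx}` finishes. The case `κ = 0` needs no separate treatment. -/
lemma IsH2.eqOn_zero {S : Set ℝ} (hS : S.OrdConnected) (hSm : MeasurableSet S)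
    {f f' f'' : ℝ → ℂ} (h : IsH2 S f f' f'') {z : ℂ}
    (hz : f'' =ᵐ[volume.restrict S] fun x => z * f x) {a : ℝ} (ha : a ∈ S)
    (h0 : f a = 0) (h1 : f' a = 0) {x : ℝ} (hx : x ∈ S) : f x = 0 := by
  obtain ⟨κ, hκ⟩ : ∃ κ : ℂ, κ ^ 2 = z := IsAlgClosed.exists_pow_nat_eq z two_pos
  have key : ∀ y ∈ S, f' y + κ * f y = 0 := fun y hy => by
    simpa [h0, h1, Complex.exp_ne_zero] using h.exp_mul_eq hS hSm hκ hz ha hy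
  have := eq_of_ae_hasDerivWithinAt_zero (g := fun x => Complex.exp (κ * x) * f x)
    hS hSm ha (fun y hy =>
      (contDiff_cexp_mul κ).contDiffOn.absolutelyContinuousOnInterval.fun_smul
        (h.absCont a ha y hy)) (by
      filter_upwards [ae_restrict_mem hSm] with y hy
      refine ((hasDerivAt_cexp_mul κ y).hasDerivWithinAt.mul (h.hasDeriv y hy)).congr_deriv ?_
      linear_combination Complex.exp (κ * y) * key y hy) hx
  simpa [h0, Complex.exp_ne_zero] using this

/-- If `c ≠ 0`, then in `p(T) = p(0) + cT - w ∫₀ᵀ p` the integral grows more slowly than any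
multiple of `T`, because `p` is square integrable. Hence `‖p T‖` grows at least linearly,
contradicting square integrability. -/
lemma eq_zero_of_memLp_of_hasDerivWithinAt {p : ℝ → ℂ} {c w : ℂ}
    (hp : MemLp p 2 (volume.restrict (Ici 0)))
    (hd : ∀ x ∈ Ici (0 : ℝ), HasDerivWithinAt p (c - w * p x) (Ici 0) x) : c = 0 := by
  by_contra hc
  have hint : IntegrableOn (fun x => ‖p x‖ ^ 2) (Ici 0) :=
    (memLp_two_iff_integrable_sq_norm hp.1).1 hp
  have hcont : ContinuousOn p (Ici 0) := fun x hx => (hd x hx).continuousWithinAt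
  set s := ∫ x in Ici (0 : ℝ), ‖p x‖ ^ 2
  have hcpos : 0 < ‖c‖ := norm_pos_iff.2 hc
  -- Chosen so that the integral term costs at most half of the linear growth `‖c‖ T`; the `+ 1`
  -- covers `w = 0`.
  set ε : ℝ := ‖c‖ / (2 * (‖w‖ + 1)) with hεdef
  have hε : 0 < ε := by positivity
  have hwε : ‖w‖ * ε ≤ ‖c‖ / 2 := by
    rw [hεdef, mul_div_assoc', div_le_div_iff₀ (by positivity) two_pos]
    nlinarith [norm_nonneg w]
  have bound : ∀ T ∈ Ici (0 : ℝ), ‖∫ x in (0 : ℝ)..T, p x‖ ≤ ε * T + s / ε := by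
    intro T hT
    have hsub : Ioc 0 T ⊆ Ici (0 : ℝ) := fun x hx => hx.1.le
    have h1 : IntervalIntegrable (fun x => ε + ‖p x‖ ^ 2 / ε) volume 0 T := by
      rw [intervalIntegrable_iff_integrableOn_Ioc_of_le hT]
      exact (integrableOn_const (by simp)).add ((hint.mono_set hsub).div_const ε)
    calc ‖∫ x in (0 : ℝ)..T, p x‖ ≤ ∫ x in (0 : ℝ)..T, (ε + ‖p x‖ ^ 2 / ε) := by
          refine intervalIntegral.norm_integral_le_of_norm_le hT
            (Filter.Eventually.of_forall fun x _ => ?_) h1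
          rw [← sub_nonneg]
          have : ε + ‖p x‖ ^ 2 / ε - ‖p x‖ =
              ((ε - ‖p x‖ / 2) ^ 2 + 3 / 4 * ‖p x‖ ^ 2) / ε := by field_simp; ring
          rw [this]
          positivity
      _ = ε * T + (∫ x in Ioc 0 T, ‖p x‖ ^ 2) / ε := by
          have h2 : Integrable (fun _ : ℝ => ε) (volume.restrict (Ioc 0 T)) :=
            integrable_const ε
          rw [intervalIntegral.integral_of_le hT, integral_add h2
            ((hint.mono_set hsub).div_const ε), integral_div ε fun x => ‖p x‖ ^ 2]
          simp [mul_comm, mem_Ici.1 hT]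
      _ ≤ ε * T + s / ε := by
          gcongr
          exact setIntegral_mono_set hint (Filter.Eventually.of_forall fun x => by positivity)
            hsub.eventuallyLE
  have ftc : ∀ T ∈ Ici (0 : ℝ), c * T - w * (∫ x in (0 : ℝ)..T, p x) = p T - p 0 := by
    intro T hT
    have hc' : ContinuousOn p (Icc 0 T) := hcont.mono Icc_subset_Ici_self
    have hpi : IntervalIntegrable p volume 0 T := hc'.intervalIntegrable_of_Icc hT
    rw [← intervalIntegral.integral_eq_sub_of_hasDerivAt_of_le hT hc'
      (fun x hx => (hd x hx.1.le).hasDerivAt (Ici_mem_nhds hx.1))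
      (intervalIntegrable_const.sub (hpi.const_mul w)),
      intervalIntegral.integral_sub intervalIntegrable_const (hpi.const_mul w)]
    simp [mul_comm]
  have large : ∀ T ∈ Ici (0 : ℝ), ‖c‖ / 2 * T - (‖w‖ * (s / ε) + ‖p 0‖) ≤ ‖p T‖ := by
    intro T hT
    have h1 : c * T = p T - p 0 + w * (∫ x in (0 : ℝ)..T, p x) := by
      linear_combination ftc T hT
    have h2 : ‖c‖ * T ≤ ‖p T‖ + ‖p 0‖ + ‖w‖ * (ε * T + s / ε) := by
      calc ‖c‖ * T = ‖c * T‖ := by simp [abs_of_nonneg (mem_Ici.1 hT)]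
        _ ≤ ‖p T - p 0‖ + ‖w * (∫ x in (0 : ℝ)..T, p x)‖ := h1 ▸ norm_add_le _ _
        _ ≤ _ := by
          rw [norm_mul]
          gcongr
          exacts [norm_sub_le _ _, bound T hT]
    nlinarith [mul_le_mul_of_nonneg_right hwε (mem_Ici.1 hT)]
  set K := ‖w‖ * (s / ε) + ‖p 0‖
  have hs : 0 ≤ s := integral_nonneg fun x => by positivity
  -- Beyond `T₀` the lower bound on `‖p‖` is at least `1`, so integrability of `‖p‖²` would make the
  -- constant `1` integrable on a half line.
  set T₀ := (1 + K) / (‖c‖ / 2)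
  have hT₀ : 0 ≤ T₀ := by positivity
  have hone : IntegrableOn (fun _ => (1 : ℝ)) (Ici T₀) := by
    refine (hint.mono_set (Ici_subset_Ici.2 hT₀)).mono' aestronglyMeasurable_const ?_
    filter_upwards [ae_restrict_mem measurableSet_Ici] with x hx
    have h1 := large x (hT₀.trans hx)
    have h2 : 1 + K ≤ ‖c‖ / 2 * x := by
      rw [mul_comm]; exact (div_le_iff₀ (by positivity)).1 hx
    have h3 : 1 ≤ ‖p x‖ := by linarith
    simpa using one_le_pow₀ h3 (n := 2)
  rw [integrableOn_const_iff] at hone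
  simp at hone

/-- On a half line, square integrable solutions are determined by their initial value. -/
lemma IsH2.eqOn_zero_of_Ici {f f' f'' : ℝ → ℂ} (h : IsH2 (Ici 0) f f' f'') {z : ℂ}
    (hz : f'' =ᵐ[volume.restrict (Ici 0)] fun x => z * f x) (h0 : f 0 = 0)
    {x : ℝ} (hx : x ∈ Ici (0 : ℝ)) : f x = 0 := by
  -- With `0 ≤ Re κ` the factor `e^{-κx}` is bounded, so `p = e^{-κx} f` stays square integrable.
  -- The first integral gives `p' = f' 0 - 2κ p`, which forces `f' 0 = 0`, also when `κ` is
  -- imaginary or zero.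
  obtain ⟨κ, hκ, hre⟩ : ∃ κ : ℂ, κ ^ 2 = z ∧ 0 ≤ κ.re := by
    obtain ⟨κ, hκ⟩ : ∃ κ : ℂ, κ ^ 2 = z := IsAlgClosed.exists_pow_nat_eq z two_pos
    rcases le_total 0 κ.re with hre | hre
    exacts [⟨κ, hκ, hre⟩, ⟨-κ, by simpa using hκ, by simpa using hre⟩]
  have h0S : (0 : ℝ) ∈ Ici (0 : ℝ) := self_mem_Ici
  refine h.eqOn_zero ordConnected_Ici measurableSet_Ici hz h0S h0 ?_ hx
  refine eq_zero_of_memLp_of_hasDerivWithinAt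
    (p := fun x => Complex.exp (-κ * x) * f x) (w := 2 * κ) ?_ fun x hx => ?_
  · refine h.memLp.mono ((contDiff_cexp_mul (n := 0) (-κ)).continuous.aestronglyMeasurable.mul
      h.memLp.1) ?_
    filter_upwards [ae_restrict_mem measurableSet_Ici] with x hx
    rw [norm_mul, Complex.norm_exp]
    refine mul_le_of_le_one_left (norm_nonneg _) (Real.exp_le_one_iff.2 ?_)
    simpa using mul_nonneg hre hx
  · refine ((hasDerivAt_cexp_mul (-κ) x).hasDerivWithinAt.mul (h.hasDeriv x hx)).congr_deriv ?_
    have := h.exp_mul_eq ordConnected_Ici measurableSet_Ici hκ hz h0S hx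
    simp only [Complex.ofReal_zero, mul_zero, Complex.exp_zero, h0, add_zero, one_mul] at this
    linear_combination this

end MetricGraph
end QuantumGraph
end


noncomputable section

namespace QuantumGraph

/-! ### Dimension counts in `𝒦 ⊕ 𝒦` -/

section LinearAlgebra

variable {K : Type*} [AddCommGroup K] [Module ℂ K] [FiniteDimensional ℂ K]

lemma exists_ne_zero_map_mem (f : K →ₗ[ℂ] K × K) {M : Submodule ℂ (K × K)}
    (hM : Module.finrank ℂ K < Module.finrank ℂ M) : ∃ c, c ≠ 0 ∧ f c ∈ M := by
  have h1 := M.finrank_quotient_add_finrank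
  have h : LinearMap.ker (M.mkQ ∘ₗ f) ≠ ⊥ := LinearMap.ker_ne_bot_of_finrank_lt (by
    rw [Module.finrank_prod] at h1
    omega)
  obtain ⟨c, hc, hc0⟩ := Submodule.exists_mem_ne_zero_of_ne_bot h
  exact ⟨c, hc0, by simpa using hc⟩

/-- The quotient by `M` has dimension below `dim K`, so it embeds in `K`; the components of the
composite `K × K → (K × K) ⧸ M → K` are `A` and `B`. -/
lemma exists_ker_coprod_eq {M : Submodule ℂ (K × K)}
    (hM : Module.finrank ℂ K < Module.finrank ℂ M) :
    ∃ A B : K →ₗ[ℂ] K, LinearMap.ker (A.coprod B) = M := by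
  have h1 := M.finrank_quotient_add_finrank
  rw [Module.finrank_prod] at h1
  obtain ⟨g, hg⟩ : ∃ g : ((K × K) ⧸ M) →ₗ[ℂ] K, Function.Injective g := by
    refine Module.Free.exists_linearMap_injective_of_rank_lt ?_
    rw [← Module.finrank_eq_rank, ← Module.finrank_eq_rank]
    exact_mod_cast (by omega : Module.finrank ℂ ((K × K) ⧸ M) < Module.finrank ℂ K)
  refine ⟨(g ∘ₗ M.mkQ) ∘ₗ LinearMap.inl ℂ K K, (g ∘ₗ M.mkQ) ∘ₗ LinearMap.inr ℂ K K, ?_⟩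
  rw [LinearMap.coprod_comp_inl_inr, LinearMap.ker_comp, LinearMap.ker_eq_bot.2 hg]
  exact M.ker_mkQ

end LinearAlgebra

/-! ### Eigenvalues and the resolvent -/

section Spectra

variable {F : Type*} [NormedAddCommGroup F] [NormedSpace ℂ F]

/-- The spectrum contains the closure of the point spectrum. -/
lemma closure_pointSpectrum_subset (T : F →ₗ.[ℂ] F) : closure (pointSpectrum T) ⊆ spectrum T := by
  rintro z hz ⟨R, -, hR⟩
  -- An eigenvector for `w` satisfies `x = (w - z) R x`, so `1 ≤ |w - z| ‖R‖`; an eigenvalue this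
  -- close to `z` violates that.
  obtain ⟨w, ⟨x, hx0, hx⟩, hw⟩ := Metric.mem_closure_iff.1 hz (‖R‖ + 1)⁻¹ (by positivity)
  have h1 : (x : F) = (w - z) • R (x : F) := by
    rw [← map_smul, sub_smul, ← hx, hR x]
  have h2 : ‖(x : F)‖ ≤ dist z w * (‖R‖ * ‖(x : F)‖) := by
    conv_lhs => rw [h1, norm_smul, ← dist_eq_norm, dist_comm]
    gcongr
    exact R.le_opNorm _
  have hpos : 0 < ‖(x : F)‖ := norm_pos_iff.2 hx0
  have h3 : dist z w * (‖R‖ + 1) < 1 := by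
    rwa [← lt_inv_mul_iff₀' (by positivity), mul_one]
  nlinarith [dist_nonneg (x := z) (y := w)]

end Spectra

/-! ### Passing between edgewise functions and operator domains -/

namespace MetricGraph

variable {V E I : Type*} [Fintype E] [Fintype I] {G : MetricGraph V E I}

lemma exists_isRep {f f' f'' : E ⊕ I → ℝ → ℂ} (h : ∀ j, IsH2 (G.edgeSet j) (f j) (f' j) (f'' j)) :
    ∃ ψ : G.maxDomain, G.IsRep ψ f f' f'' := by
  have h1 : G.IsRep (WithLp.toLp 2 fun j => (h j).memLp.toLp (f j)) f f' f'' :=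
    fun j => ⟨h j, (h j).memLp.coeFn_toLp⟩
  exact ⟨⟨_, f, f', f'', h1⟩, h1⟩

lemma IsRep.trace_eq {ψ : G.maxDomain} {f f' f'' : E ⊕ I → ℝ → ℂ} (h : G.IsRep ψ f f' f'') :
    G.trace ψ = (G.bdryVal f, G.bdryDeriv f') :=
  Prod.ext ((isRep_rep ψ).bdry_unique h).1 ((isRep_rep ψ).bdry_unique h).2

lemma IsRep.maxLaplacian_ae_eq {ψ : G.maxDomain} {f f' f'' : E ⊕ I → ℝ → ℂ}
    (h : G.IsRep ψ f f' f'') (j : E ⊕ I) :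
    (G.maxLaplacian ψ j : ℝ → ℂ) =ᵐ[volume.restrict (G.edgeSet j)] f'' j :=
  (isRep_rep ψ j).1.memLp_deriv2.coeFn_toLp.trans ((isRep_rep ψ).unique h j).2.2

lemma IsRep.eqOn_zero {f f' f'' : E ⊕ I → ℝ → ℂ} (h : G.IsRep 0 f f' f'') (j : E ⊕ I) :
    (∀ x ∈ G.edgeSet j, f j x = 0) ∧ ∀ x ∈ G.edgeSet j, f' j x = 0 := by
  have h0 : G.IsRep 0 0 0 0 := fun j => ⟨isH2_zero _, Lp.coeFn_zero ..⟩
  exact ⟨fun x hx => (h.unique h0 j).1 hx, fun x hx => (h.unique h0 j).2.1 hx⟩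

variable {M : Submodule ℂ (BdrySpace E I × BdrySpace E I)}

lemma mem_laplacian_domain (ψ : G.maxDomain) :
    (ψ : G.Hilb) ∈ (G.laplacian M).domain ↔ G.trace ψ ∈ M := by
  change (ψ : G.Hilb) ∈ _ ⊓ G.maxDomain ↔ _
  simp

lemma exists_of_laplacian_domain (x : (G.laplacian M).domain) :
    ∃ ψ : G.maxDomain, (ψ : G.Hilb) = x ∧ G.trace ψ ∈ M ∧ G.laplacian M x = G.maxLaplacian ψ :=
  ⟨⟨x, x.2.2⟩, rfl, (mem_laplacian_domain _).1 x.2, rfl⟩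

end MetricGraph
end QuantumGraph
end


noncomputable section

namespace QuantumGraph
namespace MetricGraph

/-! ### Exponential solutions -/

lemma isH2_of_hasDerivAt {S : Set ℝ} {f f' f'' : ℝ → ℂ} (hf : ∀ x, HasDerivAt f (f' x) x)
    (hf' : ∀ x, HasDerivAt f' (f'' x) x) (hc : Continuous f'')
    (h0 : MemLp f 2 (volume.restrict S)) (h2 : MemLp f'' 2 (volume.restrict S)) :
    IsH2 S f f' f'' where
  memLp := h0
  absCont _ _ _ _ := by
    refine (contDiff_one_iff_deriv.2 ⟨fun x => (hf x).differentiableAt, ?_⟩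
      ).contDiffOn.absolutelyContinuousOnInterval
    rw [funext fun x => (hf x).deriv]
    exact continuous_iff_continuousAt.2 fun x => (hf' x).continuousAt
  hasDeriv x _ := (hf x).hasDerivWithinAt
  absCont_deriv _ _ _ _ := by
    refine (contDiff_one_iff_deriv.2 ⟨fun x => (hf' x).differentiableAt, ?_⟩
      ).contDiffOn.absolutelyContinuousOnInterval
    rwa [funext fun x => (hf' x).deriv]
  hasDeriv_deriv := Filter.Eventually.of_forall fun x => (hf' x).hasDerivWithinAt
  memLp_deriv2 := h2

lemma memLp_two_Icc {a : ℝ} {f : ℝ → ℂ} (hf : Continuous f) :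
    MemLp f 2 (volume.restrict (Icc 0 a)) :=
  (memLp_two_iff_integrable_sq_norm hf.aestronglyMeasurable).2
    (hf.norm.pow 2).continuousOn.integrableOn_Icc

lemma isH2_Icc_of_hasDerivAt {a : ℝ} {f f' f'' : ℝ → ℂ} (hf : ∀ x, HasDerivAt f (f' x) x)
    (hf' : ∀ x, HasDerivAt f' (f'' x) x) (hc : Continuous f'') : IsH2 (Icc 0 a) f f' f'' :=
  isH2_of_hasDerivAt hf hf' hc
    (memLp_two_Icc (continuous_iff_continuousAt.2 fun x => (hf x).continuousAt))
    (memLp_two_Icc hc)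

lemma isH2_Icc_cexp (a : ℝ) (w : ℂ) : IsH2 (Icc 0 a) (fun x => Complex.exp (w * x))
    (fun x => w * Complex.exp (w * x)) (fun x => w * (w * Complex.exp (w * x))) :=
  isH2_Icc_of_hasDerivAt (hasDerivAt_cexp_mul w) (fun x => (hasDerivAt_cexp_mul w x).const_mul w)
    (by fun_prop)

lemma isH2_Ici_cexp {w : ℂ} (hw : w.re < 0) : IsH2 (Ici 0) (fun x => Complex.exp (w * x))
    (fun x => w * Complex.exp (w * x)) (fun x => w * (w * Complex.exp (w * x))) := by
  have h : MemLp (fun x : ℝ => Complex.exp (w * x)) 2 (volume.restrict (Ici 0)) := by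
    rw [memLp_two_iff_integrable_sq_norm
      (contDiff_cexp_mul (n := 0) w).continuous.aestronglyMeasurable]
    refine (integrableOn_Ici_iff_integrableOn_Ioi (μ := volume)).2 ?_
    refine (integrableOn_exp_mul_Ioi (a := 2 * w.re) (by linarith) 0).congr_fun (fun x _ => ?_)
      measurableSet_Ioi
    simp only [Complex.norm_exp, Complex.re_mul_ofReal]
    rw [← Real.exp_nat_mul]
    congr 1
    push_cast
    ring
  exact isH2_of_hasDerivAt (hasDerivAt_cexp_mul w)
    (fun x => (hasDerivAt_cexp_mul w x).const_mul w) (by fun_prop) h ((h.const_mul w).const_mul w)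

variable {V E I : Type*} [Fintype E] [Fintype I] {G : MetricGraph V E I}

/-- The edgewise solutions `s e^{ikx}` and `α e^{ikx} + β e^{-ikx}` of `-ψ'' = k² ψ`. -/
def expSol (k : ℂ) (c : BdrySpace E I) : E ⊕ I → ℝ → ℂ
  | .inl e => c (.inl e) • fun x : ℝ => Complex.exp (Complex.I * k * x)
  | .inr i => (c (.inr (.inl i)) • fun x : ℝ => Complex.exp (Complex.I * k * x)) +
      c (.inr (.inr i)) • fun x : ℝ => Complex.exp (-(Complex.I * k) * x)

/-- The derivatives of `expSol`. -/
def expSolDeriv (k : ℂ) (c : BdrySpace E I) : E ⊕ I → ℝ → ℂ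
  | .inl e => c (.inl e) • fun x : ℝ => Complex.I * k * Complex.exp (Complex.I * k * x)
  | .inr i => (c (.inr (.inl i)) • fun x : ℝ => Complex.I * k * Complex.exp (Complex.I * k * x)) +
      c (.inr (.inr i)) • fun x : ℝ => -(Complex.I * k) * Complex.exp (-(Complex.I * k) * x)

lemma isH2_expSol {k : ℂ} (hk : 0 < k.im) (c : BdrySpace E I) (j : E ⊕ I) :
    IsH2 (G.edgeSet j) (expSol k c j) (expSolDeriv k c j) ((-k ^ 2) • expSol k c j) := by
  have hI : ∀ w : ℂ, Complex.I * k * (Complex.I * k * w) = -k ^ 2 * w := fun w => by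
    linear_combination k ^ 2 * w * Complex.I_sq
  rcases j with e | i
  · have h := (isH2_Ici_cexp (w := Complex.I * k) (by simpa using hk)).smul (c (.inl e))
    convert! h using 1
    ext x
    simp only [expSol, Pi.smul_apply, smul_eq_mul, hI]
    ring
  · have h := ((isH2_Icc_cexp (G.len i) (Complex.I * k)).smul (c (.inr (.inl i)))).add
      ((isH2_Icc_cexp (G.len i) (-(Complex.I * k))).smul (c (.inr (.inr i))))
    convert! h using 1
    ext x
    simp only [expSol, Pi.smul_apply, Pi.add_apply, smul_eq_mul, neg_mul, mul_neg, hI]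
    ring

lemma finrank_bdrySpace :
    Module.finrank ℂ (BdrySpace E I) = Fintype.card E + 2 * Fintype.card I := by
  simp [two_mul]

variable [DecidableEq E] [DecidableEq I]

lemma bdryVal_expSol (k : ℂ) (c : BdrySpace E I) :
    G.bdryVal (expSol k c) = Matrix.toEuclideanLin (G.matX k) c := by
  ext j
  rcases j with e | i | i <;>
    simp [bdryVal, expSol, matX, expMatrix, Matrix.toLpLin_apply, Matrix.mulVec,
      dotProduct, Fintype.sum_sum_type, Matrix.one_apply, Matrix.diagonal_apply, mul_comm]

lemma bdryDeriv_expSolDeriv (k : ℂ) (c : BdrySpace E I) :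
    G.bdryDeriv (expSolDeriv k c) =
      (Complex.I * k) • Matrix.toEuclideanLin (G.matY k) c := by
  ext j
  rcases j with e | i | i <;>
    simp [bdryDeriv, expSolDeriv, matY, expMatrix, Matrix.toLpLin_apply, Matrix.mulVec,
      dotProduct, Fintype.sum_sum_type, Matrix.one_apply, Matrix.diagonal_apply] <;> ring

/-- The boundary values `(X(k) c, ik Y(k) c)` of the exponential solutions. -/
def expTrace (G : MetricGraph V E I) (k : ℂ) :
    BdrySpace E I →ₗ[ℂ] BdrySpace E I × BdrySpace E I :=
  (Matrix.toEuclideanLin (G.matX k)).prod ((Complex.I * k) • Matrix.toEuclideanLin (G.matY k))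

variable {M : Submodule ℂ (BdrySpace E I × BdrySpace E I)}

/-- The condition `Im k > 0` makes `e^{ikx}` decay on the external edges. The eigenfunction is
nonzero because its values and derivatives at the initial ends recover `c`, using `k ≠ 0` on
internal edges. -/
lemma neg_sq_mem_pointSpectrum
    (hM : Fintype.card E + 2 * Fintype.card I < Module.finrank ℂ M) {k : ℂ} (hk : 0 < k.im) :
    -k ^ 2 ∈ pointSpectrum (G.laplacian M) := by
  obtain ⟨c, hc, hcM⟩ := exists_ne_zero_map_mem (G.expTrace k) (finrank_bdrySpace.trans_lt hM)
  obtain ⟨ψ, hψ⟩ := exists_isRep (G := G) (isH2_expSol hk c)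
  have htr : G.trace ψ ∈ M := by
    rw [hψ.trace_eq, bdryVal_expSol, bdryDeriv_expSolDeriv]
    exact hcM
  refine ⟨⟨ψ, (mem_laplacian_domain ψ).2 htr⟩, fun h0 => hc ?_, ?_⟩
  · replace h0 : (ψ : G.Hilb) = 0 := h0
    rw [h0] at hψ
    have hk0 : k ≠ 0 := fun h => by simp [h] at hk
    ext j
    rcases j with e | i | i
    · simpa [expSol] using (hψ.eqOn_zero (.inl e)).1 0 (by simp [edgeSet])
    all_goals
      have h1 := (hψ.eqOn_zero (.inr i)).1 0 (by simp [edgeSet, (G.len_pos i).le])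
      have h2 := (hψ.eqOn_zero (.inr i)).2 0 (by simp [edgeSet, (G.len_pos i).le])
      simp only [expSol, expSolDeriv, Pi.add_apply, Pi.smul_apply, smul_eq_mul,
        Complex.ofReal_zero, mul_zero, Complex.exp_zero, mul_one] at h1 h2
      have hIk : Complex.I * k ≠ 0 := mul_ne_zero Complex.I_ne_zero hk0
      have h3 : c (.inr (.inl i)) - c (.inr (.inr i)) = 0 :=
        (mul_eq_zero_iff_left hIk).1 (by linear_combination h2)
      simp only [PiLp.zero_apply]
    · linear_combination (h1 + h3) / 2
    · linear_combination (h1 - h3) / 2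
  · change G.maxLaplacian ψ = _
    ext1 j
    refine Lp.ext ?_
    refine (hψ.maxLaplacian_ae_eq j).trans ?_
    rw [PiLp.smul_apply]
    refine Filter.EventuallyEq.symm ((Lp.coeFn_smul _ _).trans ?_)
    filter_upwards [(hψ j).2] with x hx
    simp only [Pi.smul_apply, hx]

lemma closure_pointSpectrum_eq_univ
    (hM : Fintype.card E + 2 * Fintype.card I < Module.finrank ℂ M) :
    closure (pointSpectrum (G.laplacian M)) = univ := by
  -- A square root `k` of `-z` is nonreal for nonreal `z`; one of `k`, `-k` lies in the upper half
  -- plane.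
  have key : ∀ z : ℂ, z.im ≠ 0 → z ∈ pointSpectrum (G.laplacian M) := by
    intro z hz
    obtain ⟨k, hk⟩ : ∃ k : ℂ, k ^ 2 = -z := IsAlgClosed.exists_pow_nat_eq (-z) two_pos
    have him : k.im ≠ 0 := by
      intro h
      apply hz
      have := congrArg Complex.im hk
      simpa [sq, h] using this.symm
    rcases him.lt_or_gt with h | h
    · have := neg_sq_mem_pointSpectrum (G := G) hM (k := -k) (by simpa using h)
      rwa [neg_sq, hk, neg_neg] at this
    · have := neg_sq_mem_pointSpectrum (G := G) hM h
      rwa [hk, neg_neg] at this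
  refine (Dense.mono (s₁ := {z : ℂ | z.im ≠ 0}) (fun z hz => key z hz) ?_).closure_eq
  intro z
  refine Metric.mem_closure_iff.2 fun ε hε => ?_
  by_cases hz : z.im = 0
  · refine ⟨z + (ε / 2 : ℝ) * Complex.I, by simp [hz, hε.ne'], ?_⟩
    rw [dist_self_add_right]
    simp [abs_of_pos hε]
    linarith
  · exact ⟨z, hz, by simpa using hε⟩

/-- This uses only the boundary vectors, not square integrability, so `k` may be real or zero. -/
lemma det_secularMap_eq_zero
    (hM : Fintype.card E + 2 * Fintype.card I < Module.finrank ℂ M)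
    {A B : BdrySpace E I →ₗ[ℂ] BdrySpace E I} (hAB : bdrySubspace A B = M) (k : ℂ) :
    LinearMap.det (G.secularMap A B k) = 0 := by
  obtain ⟨c, hc, hcM⟩ := exists_ne_zero_map_mem (G.expTrace k) (finrank_bdrySpace.trans_lt hM)
  rw [← hAB] at hcM
  refine LinearMap.det_eq_zero_iff_ker_ne_bot.2 fun h => hc ?_
  rw [← Submodule.mem_bot ℂ, ← h]
  simpa [secularMap, expTrace, bdrySubspace] using hcM

end MetricGraph
end QuantumGraph
end


noncomputable section

namespace QuantumGraph
namespace MetricGraph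

/-! ### The range of the Laplacian -/

lemma exists_isH2_Ici (u v : ℂ) :
    ∃ f f' f'' : ℝ → ℂ, IsH2 (Ici 0) f f' f'' ∧ f 0 = u ∧ f' 0 = v := by
  -- Two distinct decay rates, `e^{-x}` and `e^{-2x}`, suffice to match value and slope.
  refine ⟨_, _, _, ((isH2_Ici_cexp (w := -1) (by simp)).smul (2 * u + v)).add
    ((isH2_Ici_cexp (w := -2) (by simp)).smul (-(u + v))), ?_, ?_⟩ <;> simp <;> ring

lemma exists_isH2_Icc {a : ℝ} (ha : 0 < a) (u v p q : ℂ) :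
    ∃ f f' f'' : ℝ → ℂ, IsH2 (Icc 0 a) f f' f'' ∧ f 0 = u ∧ f' 0 = v ∧ f a = p ∧ f' a = q := by
  have ha' : (a : ℂ) ≠ 0 := by exact_mod_cast ha.ne'
  have hpow : ∀ (n : ℕ) (x : ℝ), HasDerivAt (fun x : ℝ => (x : ℂ) ^ n) (n * (x : ℂ) ^ (n - 1)) x :=
    fun n x => by simpa using! (Complex.ofRealCLM.hasDerivAt (x := x)).pow n
  -- Cubic Hermite interpolation: `r` and `s` are the quadratic and cubic coefficients.
  set r : ℂ := 3 * (p - u) / a ^ 2 - (2 * v + q) / a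
  set s : ℂ := 2 * (u - p) / a ^ 3 + (v + q) / a ^ 2
  refine ⟨fun x => u + v * (x : ℂ) ^ 1 + r * (x : ℂ) ^ 2 + s * (x : ℂ) ^ 3,
    fun x => v + 2 * r * (x : ℂ) ^ 1 + 3 * s * (x : ℂ) ^ 2, fun x => 2 * r + 6 * s * x,
    isH2_Icc_of_hasDerivAt (fun x => ?_) (fun x => ?_) (by fun_prop), ?_, ?_, ?_, ?_⟩
  · refine (((((hpow 1 x).const_mul v).const_add u).add ((hpow 2 x).const_mul r)).add
      ((hpow 3 x).const_mul s)).congr_deriv ?_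
    norm_num
    ring
  · refine ((((hpow 1 x).const_mul (2 * r)).const_add v).add
      ((hpow 2 x).const_mul (3 * s))).congr_deriv ?_
    norm_num
    ring
  · simp
  · simp
  · simp only [r, s]; field_simp; ring
  · simp only [r, s]; field_simp; ring

variable {V E I : Type*} [Fintype E] [Fintype I] {G : MetricGraph V E I}

lemma trace_surjective : Function.Surjective G.trace := by
  rintro ⟨χ, η⟩
  have h : ∀ j : E ⊕ I, ∃ f f' f'' : ℝ → ℂ, IsH2 (G.edgeSet j) f f' f'' ∧
      match j with
      | .inl e => f 0 = χ (.inl e) ∧ f' 0 = η (.inl e)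
      | .inr i => f 0 = χ (.inr (.inl i)) ∧ f' 0 = η (.inr (.inl i)) ∧
          f (G.len i) = χ (.inr (.inr i)) ∧ f' (G.len i) = -η (.inr (.inr i)) := by
    rintro (e | i)
    · exact exists_isH2_Ici _ _
    · exact exists_isH2_Icc (G.len_pos i) _ _ _ _
  choose f f' f'' hf hb using h
  obtain ⟨ψ, hψ⟩ := exists_isRep hf
  refine ⟨ψ, ?_⟩
  rw [hψ.trace_eq]
  refine Prod.ext ?_ ?_ <;> ext j <;> rcases j with e | i | i
  exacts [(hb (.inl e)).1, (hb (.inr i)).1, (hb (.inr i)).2.2.1, (hb (.inl e)).2,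
    (hb (.inr i)).2.1, neg_eq_iff_eq_neg.2 (hb (.inr i)).2.2.2]

/-- The space of square integrable solutions of `ψ'' = z ψ`, without boundary conditions. -/
def deficiencySpace (G : MetricGraph V E I) (z : ℂ) : Submodule ℂ G.maxDomain :=
  LinearMap.ker ((show G.maxDomain →ₗ[ℂ] G.Hilb from G.maxLaplacian.toFun) -
    z • G.maxDomain.subtype)

lemma mem_deficiencySpace {z : ℂ} {ψ : G.maxDomain} :
    ψ ∈ G.deficiencySpace z ↔ G.maxLaplacian ψ = z • (ψ : G.Hilb) := by
  change G.maxLaplacian ψ - z • (ψ : G.Hilb) = 0 ↔ _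
  exact sub_eq_zero

/-- The values at the initial vertices together with the derivatives at the initial vertices of
the internal edges. -/
def initialData (E I : Type*) [Fintype E] [Fintype I] :
    BdrySpace E I × BdrySpace E I →ₗ[ℂ] BdrySpace E I where
  toFun χ := WithLp.toLp 2 fun
    | .inl e => χ.1 (.inl e)
    | .inr (.inl i) => χ.1 (.inr (.inl i))
    | .inr (.inr i) => χ.2 (.inr (.inl i))
  map_add' χ η := by ext j; rcases j with e | i | i <;> simp
  map_smul' c χ := by ext j; rcases j with e | i | i <;> simp

lemma eq_zero_of_mem_deficiencySpace {z : ℂ} {ψ : G.maxDomain} (hψ : ψ ∈ G.deficiencySpace z)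
    (h0 : initialData E I (G.trace ψ) = 0) : ψ = 0 := by
  have hrep := isRep_rep ψ
  have hz : ∀ j, rep'' ψ j =ᵐ[volume.restrict (G.edgeSet j)] fun x => z * rep ψ j x := by
    intro j
    have h1 := hrep.maxLaplacian_ae_eq j
    rw [mem_deficiencySpace.1 hψ] at h1
    filter_upwards [h1, Lp.coeFn_smul z ((ψ : G.Hilb) j), (hrep j).2] with x h2 h3 h4
    rw [← h2, PiLp.smul_apply, h3, Pi.smul_apply, h4, smul_eq_mul]
  rw [hrep.trace_eq] at h0
  have hval : ∀ j, ∀ x ∈ G.edgeSet j, rep ψ j x = 0 := by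
    rintro (e | i) x hx
    · exact (hrep (.inl e)).1.eqOn_zero_of_Ici (hz (.inl e))
        (congrArg (fun v : BdrySpace E I => v (.inl e)) h0) hx
    · exact (hrep (.inr i)).1.eqOn_zero ordConnected_Icc measurableSet_Icc (hz (.inr i))
        (left_mem_Icc.2 (G.len_pos i).le)
        (congrArg (fun v : BdrySpace E I => v (.inr (.inl i))) h0)
        (congrArg (fun v : BdrySpace E I => v (.inr (.inr i))) h0) hx
  ext1
  ext1 j
  refine Lp.ext (((hrep j).2.trans ?_).trans (Lp.coeFn_zero ..).symm)
  filter_upwards [ae_restrict_mem (G.measurableSet_edgeSet j)] with x hx using hval j x hx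

/-- Square integrability removes one of the two free parameters on each external edge, so
`initialData`, with values in a `d`-dimensional space, is injective on these traces. -/
lemma finrank_map_trace_deficiencySpace_le (z : ℂ) :
    Module.finrank ℂ ((G.deficiencySpace z).map G.trace) ≤ Fintype.card E + 2 * Fintype.card I := by
  rw [← finrank_bdrySpace (E := E) (I := I)]
  refine LinearMap.finrank_le_finrank_of_injective
    (f := (initialData E I).domRestrict ((G.deficiencySpace z).map G.trace)) ?_
  rw [← LinearMap.ker_eq_bot, LinearMap.ker_eq_bot']
  rintro ⟨_, ψ, hψ, rfl⟩ h
  have := eq_zero_of_mem_deficiencySpace hψ h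
  simp [this]

variable {M : Submodule ℂ (BdrySpace E I × BdrySpace E I)}

/-- Already surjectivity of `Δ(M) - z` fails: it would make `M` and the traces of homogeneous
solutions span `𝒦 ⊕ 𝒦`. -/
lemma spectrum_eq_univ_of_finrank_lt
    (hM : Module.finrank ℂ M < Fintype.card E + 2 * Fintype.card I) :
    spectrum (G.laplacian M) = univ := by
  refine eq_univ_of_forall ?_
  rintro z ⟨R, hR, -⟩
  have htop : M ⊔ (G.deficiencySpace z).map G.trace = ⊤ := by
    refine eq_top_iff.2 fun χ _ => ?_
    obtain ⟨ψ, rfl⟩ := trace_surjective (G := G) χ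
    obtain ⟨x, -, hx⟩ := hR (G.maxLaplacian ψ - z • (ψ : G.Hilb))
    obtain ⟨φ, hφ, hφM, hφx⟩ := exists_of_laplacian_domain x
    rw [hφx, ← hφ] at hx
    refine Submodule.mem_sup.2 ⟨G.trace φ, hφM, G.trace (ψ - φ),
      Submodule.mem_map_of_mem (mem_deficiencySpace.2 ?_), by simp⟩
    have h1 : G.maxLaplacian (ψ - φ) = G.maxLaplacian ψ - G.maxLaplacian φ :=
      G.maxLaplacian.map_sub ψ φ
    rw [h1, AddSubgroupClass.coe_sub, smul_sub, sub_eq_sub_iff_sub_eq_sub]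
    exact hx.symm
  have h1 := Submodule.finrank_add_le_finrank_add_finrank M ((G.deficiencySpace z).map G.trace)
  rw [htop, finrank_top, Module.finrank_prod, finrank_bdrySpace] at h1
  have h2 := finrank_map_trace_deficiencySpace_le (G := G) z
  omega

end MetricGraph
end QuantumGraph
end
theorem mainTheorem10 {V E I : Type*} [Finite V] [Fintype E] [Fintype I]
    [DecidableEq E] [DecidableEq I] (G : QuantumGraph.MetricGraph V E I)
    (M : Submodule ℂ (QuantumGraph.BdrySpace E I × QuantumGraph.BdrySpace E I)) :
    (Module.finrank ℂ M ≠ Fintype.card E + 2 * Fintype.card I →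
      QuantumGraph.spectrum (G.laplacian M) = Set.univ) ∧
    (Fintype.card E + 2 * Fintype.card I < Module.finrank ℂ M →
      closure (QuantumGraph.pointSpectrum (G.laplacian M)) = Set.univ ∧
      (∃ A B : QuantumGraph.BdrySpace E I →ₗ[ℂ] QuantumGraph.BdrySpace E I,
        QuantumGraph.bdrySubspace A B = M) ∧
      ∀ A B : QuantumGraph.BdrySpace E I →ₗ[ℂ] QuantumGraph.BdrySpace E I,
        QuantumGraph.bdrySubspace A B = M →
        ∀ k : ℂ, LinearMap.det (G.secularMap A B k) = 0) := by
  refine ⟨fun hne => ?_, fun h => ⟨QuantumGraph.MetricGraph.closure_pointSpectrum_eq_univ h,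
    QuantumGraph.exists_ker_coprod_eq (QuantumGraph.MetricGraph.finrank_bdrySpace.trans_lt h),
    fun A B hAB k => QuantumGraph.MetricGraph.det_secularMap_eq_zero h hAB k⟩⟩
  rcases hne.lt_or_gt with h | h
  · exact QuantumGraph.MetricGraph.spectrum_eq_univ_of_finrank_lt h
  · refine eq_univ_of_univ_subset ?_
    rw [← QuantumGraph.MetricGraph.closure_pointSpectrum_eq_univ (G := G) h]
    exact QuantumGraph.closure_pointSpectrum_subset _
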